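/- **Setting.** Let $n\ge 1$; sets are Lebesgue measurable subsets of $\mathbb R^n$, $|\cdot|$ is Lebesgue measure, $B_r(x)$ is the open ball, $\mathcal C A=\mathbb R^n\setminus A$, and $\omega_n$ is the area of the unit sphere of $\mathbb R^n$. For $s\in(0,1)$, the fractional perimeter of $E$ in an open set $\Omega$ is $$P_s(E,\Omega)=\mathcal L_s(E\cap\Omega,\mathcal C E)+\mathcal L_s(E\setminus\Omega,\Omega\setminus E),\qquad \mathcal L_s(A,B)=\int_A\int_B\frac{dx\,dy}{|x-y|^{n+s}}.$$ A set $E$ is *$s$-minimal in $\Omega$* if $P_s(E,\Omega)<\infty$ and $P_s(E,\Omega)\le P_s(F,\Omega)$ for every $F$ with $F\setminus\Omega=E\setminus\Omega$. It has *exterior data* $E_0$ if $E\setminus\Omega=E_0$ up to a null set. As usual, $E$ is represented, in its class modulo null sets, so that it contains every point $x$ with $|E\cap B_r(x)|=|B_r(x)|$ for some $r>0$, and contains no point $x$ with $|E\cap B_r(x)|=0$ for some $r>0$. Finally, let $$\overline\alpha(E_0)=\limsup_{s\to0^+}\,s\int_{E_0\setminus B_1(0)}\frac{dy}{|y|^{n+s}}.$$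 **Theorem.** Let $\Omega\subset\mathbb R^n$ be a bounded connected open set with $C^2$ boundary, and let $E_0\subset\mathcal C\Omega$ be such that $$\overline\alpha(E_0)<\frac{\omega_n}{2}.$$ Suppose that there exist $R>0$ and $x_0\in\partial\Omega$ such that $B_R(x_0)\setminus\Omega\subset\mathcal C E_0$. Then for every $s_1\in(0,1)$ there exists $s_3\in(0,s_1]$ such that, for every $s\in(0,s_3)$, every set $E$ that is $s$-minimal in $\Omega$ with exterior data $E_0$ satisfies $$E\cap\Omega=\emptyset.$$ -/

import Mathlib

open MeasureTheory Metric Set Filter Topology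
open scoped ENNReal

namespace NonlocalMinimal

/-- The interaction `L_s(A, B) = ∫_A ∫_B |x - y|^{-(n+s)} dy dx`, with values in `[0, ∞]`. -/
noncomputable def interaction {n : ℕ} (s : ℝ) (A B : Set (EuclideanSpace ℝ (Fin n))) : ℝ≥0∞ :=
  ∫⁻ x in A, ∫⁻ y in B, ENNReal.ofReal (1 / ‖x - y‖ ^ ((n : ℝ) + s))

/-- The fractional perimeter `P_s(E, Ω) = L_s(E ∩ Ω, Eᶜ) + L_s(E \ Ω, Ω \ E)`. -/
noncomputable def fracPerimeter {n : ℕ} (s : ℝ) (E Ω : Set (EuclideanSpace ℝ (Fin n))) : ℝ≥0∞ :=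
  interaction s (E ∩ Ω) Eᶜ + interaction s (E \ Ω) (Ω \ E)

/-- `E` is `s`-minimal in `Ω`: its `s`-perimeter in `Ω` is finite, and is at most that of every
competitor, that is of every set which agrees with `E` outside `Ω`. Sets are Lebesgue measurable
(`NullMeasurableSet` for the Lebesgue measure). -/
structure IsSMinimal {n : ℕ} (s : ℝ) (Ω E : Set (EuclideanSpace ℝ (Fin n))) : Prop where
  measurable : NullMeasurableSet E volume
  finite : fracPerimeter s E Ω < ∞
  le_competitor : ∀ F : Set (EuclideanSpace ℝ (Fin n)), NullMeasurableSet F volume →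
    F \ Ω = E \ Ω → fracPerimeter s E Ω ≤ fracPerimeter s F Ω

/-- The measure theoretic interior of `E`. -/
def measInterior {n : ℕ} (E : Set (EuclideanSpace ℝ (Fin n))) :
    Set (EuclideanSpace ℝ (Fin n)) :=
  {x | ∃ r : ℝ, 0 < r ∧ volume (E ∩ ball x r) = volume (ball x r)}

/-- The measure theoretic exterior of `E`. -/
def measExterior {n : ℕ} (E : Set (EuclideanSpace ℝ (Fin n))) :
    Set (EuclideanSpace ℝ (Fin n)) :=
  {x | ∃ r : ℝ, 0 < r ∧ volume (E ∩ ball x r) = 0}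

/-- The usual choice of representative of `E` in its class modulo null sets: `E` contains its
measure theoretic interior and is disjoint from its measure theoretic exterior. The topological
boundary of `E` is then its measure theoretic boundary, see `IsNormalized.frontier_eq`. -/
structure IsNormalized {n : ℕ} (E : Set (EuclideanSpace ℝ (Fin n))) : Prop where
  interior_subset : measInterior E ⊆ E
  exterior_subset : measExterior E ⊆ Eᶜ

theorem IsNormalized.frontier_eq {n : ℕ} {E : Set (EuclideanSpace ℝ (Fin n))}
    (h : IsNormalized E) : frontier E = (measInterior E ∪ measExterior E)ᶜ := by
  have h1 : interior E = measInterior E := by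
    ext x
    constructor
    · intro hx
      obtain ⟨r, hr, hb⟩ := Metric.mem_nhds_iff.1 (mem_interior_iff_mem_nhds.1 hx)
      exact ⟨r, hr, by rw [inter_eq_self_of_subset_right hb]⟩
    · rintro ⟨r, hr, hb⟩
      refine mem_interior_iff_mem_nhds.2 (Metric.mem_nhds_iff.2 ⟨r, hr, fun y hy => ?_⟩)
      refine h.interior_subset ⟨r - dist y x, sub_pos.2 hy, ?_⟩
      have hsub : ball y (r - dist y x) ⊆ ball x r := ball_subset_ball' (by linarith)
      refine le_antisymm (measure_mono inter_subset_right) ?_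
      have hle : volume (ball x r) ≤ volume (E ∩ ball y (r - dist y x)) +
          volume (ball x r \ ball y (r - dist y x)) := by
        rw [← hb]
        refine (measure_mono ?_).trans (measure_union_le _ _)
        rintro z ⟨hzE, hzb⟩
        by_cases hz : z ∈ ball y (r - dist y x)
        · exact Or.inl ⟨hzE, hz⟩
        · exact Or.inr ⟨hzb, hz⟩
      rw [← measure_inter_add_sdiff (ball x r) (measurableSet_ball (x := y) (ε := r - dist y x)),
        inter_eq_self_of_subset_right hsub] at hle
      exact (ENNReal.add_le_add_iff_right
        (measure_ne_top_of_subset sdiff_subset measure_ball_lt_top.ne)).1 hle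
  have h2 : (closure E)ᶜ = measExterior E := by
    rw [← interior_compl]
    ext x
    constructor
    · intro hx
      obtain ⟨r, hr, hb⟩ := Metric.mem_nhds_iff.1 (mem_interior_iff_mem_nhds.1 hx)
      refine ⟨r, hr, ?_⟩
      rw [(disjoint_left.2 fun z hz hz' => hb hz' hz : Disjoint E (ball x r)).inter_eq]
      exact measure_empty
    · rintro ⟨r, hr, hb⟩
      refine mem_interior_iff_mem_nhds.2 (Metric.mem_nhds_iff.2 ⟨r, hr, fun y hy => ?_⟩)
      refine h.exterior_subset ⟨r - dist y x, sub_pos.2 hy, ?_⟩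
      exact measure_mono_null
        (inter_subset_inter_right E (ball_subset_ball' (by linarith))) hb
  rw [compl_union, ← h1, ← h2, compl_compl, frontier, sdiff_eq, inter_comm]

/-- `ω_n`, the area of the unit sphere of `ℝⁿ`: the total mass of the surface measure induced on
the unit sphere by the Lebesgue measure. -/
noncomputable def sphereArea (n : ℕ) : ℝ≥0∞ :=
  (volume : Measure (EuclideanSpace ℝ (Fin n))).toSphere univ

theorem sphereArea_eq (n : ℕ) :
    sphereArea n = n * volume (ball (0 : EuclideanSpace ℝ (Fin n)) 1) := by
  simp [sphereArea, Measure.toSphere_apply_univ]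

/-- The upper contribution from infinity
`limsup_{s → 0⁺} s ∫_{E \ B_1} |y|^{-(n+s)} dy`. -/
noncomputable def upperAlpha {n : ℕ} (E : Set (EuclideanSpace ℝ (Fin n))) : ℝ≥0∞ :=
  limsup (fun s : ℝ => ENNReal.ofReal s *
    ∫⁻ y in E \ ball 0 1, ENNReal.ofReal (1 / ‖y‖ ^ ((n : ℝ) + s))) (𝓝[>] (0 : ℝ))

/-- The open set `Ω` has `C²` boundary: near each of its boundary points, `Ω` is the sublevel set
`{φ < 0}` of a `C²` function with non-vanishing differential. -/
def HasC2Boundary {n : ℕ} (Ω : Set (EuclideanSpace ℝ (Fin n))) : Prop :=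
  ∀ x ∈ frontier Ω, ∃ r : ℝ, 0 < r ∧ ∃ φ : EuclideanSpace ℝ (Fin n) → ℝ,
    ContDiffOn ℝ 2 φ (ball x r) ∧ (∀ y ∈ ball x r, fderiv ℝ φ y ≠ 0) ∧
    Ω ∩ ball x r = {y | φ y < 0} ∩ ball x r

end NonlocalMinimal

/-!
Let `K(x, y) = |x - y|^{-(n+s)}` and let `L(A, B)` be the interaction of `A` and `B`. The proof
compares a minimal set `E` with `E \ A` for suitable `A ⊆ E ∩ Ω`. By minimality
`L(A, Eᶜ) ≤ L(A, E \ A)` (`IsSMinimal.interaction_le`), and the strategy is to contradict this for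
small `s` unless `A` is a null set.

* At infinity, `E` agrees with `E₀`, and the bound on `upperAlpha E₀` makes the far part of
  `L(A, Eᶜ) - L(A, E \ A)` at least `η |A| / s` with a fixed `η > 0` (`exists_eventually_far_le`).
* Suppose that `E` misses the ball `B_δ(c)` and has no exterior data in `B_r(c)`, and let
  `A = E ∩ B_r(c)`. The near part of `L(A, E \ A) - L(A, Eᶜ)` is then at most
  `L(A, B_τ(c) \ B_r(c)) - L(A, B_r(c) \ A)` for a large `τ`. The spheres centred at `c` calibrate
  this difference: it is at most the integral over `x ∈ A` of the nonlocal mean curvature of the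
  sphere through `x`, because the contributions of `A × A` cancel by antisymmetry. The curvatures
  of spheres of radius at least `δ` are bounded uniformly in `s ≤ 1/2`, hence the difference is at
  most `Q |A|` (`exists_interaction_le_of_subset_ball`).

Since `Q < η / s` for small `s`, it follows that `E` misses all of `B_r(c)`
(`eventually_volume_inter_ball_eq_zero`). So an empty ball of fixed radius spreads to every larger
concentric ball without exterior data, once `s` is small. The exterior of `Ω` near `x₀` contains an
empty ball, which spreads across `∂Ω` into `Ω`, from there to any compact subset of `Ω` by
connectedness (`EventuallyNull.of_isCompact`), and finally up to the boundary, because `Ω` is a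
union of closed balls of one fixed radius, its boundary being of class `C²`
(`HasC2Boundary.exists_interior_closedBall`). In each step the threshold for `s` is independent of
`E`. No regularity of minimal sets is needed; the normalization of `E` serves only to pass from
null sets to empty sets at the end.
-/

namespace NonlocalMinimal

variable {n : ℕ}


/-! ### Interactions with respect to a symmetric kernel -/

/-- The double integral `∫_A ∫_B k(x, y) dy dx` of a kernel `k` on `ℝⁿ`. The general kernel serves
to treat `|x - y|^{-(n+s)}` and its bounded truncations at the same time. -/
noncomputable def pairIntegral (k : EuclideanSpace ℝ (Fin n) → EuclideanSpace ℝ (Fin n) → ℝ≥0∞)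
    (A B : Set (EuclideanSpace ℝ (Fin n))) : ℝ≥0∞ :=
  ∫⁻ x in A, ∫⁻ y in B, k x y

section pairIntegral

variable {k : EuclideanSpace ℝ (Fin n) → EuclideanSpace ℝ (Fin n) → ℝ≥0∞}
  {A B C : Set (EuclideanSpace ℝ (Fin n))}

theorem pairIntegral_comm (hk : Measurable (Function.uncurry k)) (hsymm : ∀ x y, k x y = k y x)
    (A B : Set (EuclideanSpace ℝ (Fin n))) : pairIntegral k A B = pairIntegral k B A := by
  unfold pairIntegral
  rw [lintegral_lintegral_swap hk.aemeasurable]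
  simp_rw [fun x y => hsymm x y]

theorem pairIntegral_mono_right (h : B ≤ᵐ[volume] C) : pairIntegral k A B ≤ pairIntegral k A C :=
  lintegral_mono fun _ => lintegral_mono' (Measure.restrict_mono_ae h) le_rfl

theorem pairIntegral_union_left (hAB : AEDisjoint volume A B) (hB : NullMeasurableSet B volume) :
    pairIntegral k (A ∪ B) C = pairIntegral k A C + pairIntegral k B C := by
  simp only [pairIntegral, Measure.restrict_union₀ hAB hB, lintegral_add_measure]

theorem pairIntegral_union_right (hk : Measurable (Function.uncurry k))
    (hBC : AEDisjoint volume B C) (hC : NullMeasurableSet C volume) :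
    pairIntegral k A (B ∪ C) = pairIntegral k A B + pairIntegral k A C := by
  simp only [pairIntegral, Measure.restrict_union₀ hBC hC, lintegral_add_measure]
  exact lintegral_add_left hk.lintegral_prod_right' _

theorem pairIntegral_union_right_le (hk : Measurable (Function.uncurry k))
    (A B C : Set (EuclideanSpace ℝ (Fin n))) :
    pairIntegral k A (B ∪ C) ≤ pairIntegral k A B + pairIntegral k A C := by
  unfold pairIntegral
  have hB : Measurable fun x => ∫⁻ y in B, k x y := hk.lintegral_prod_right'
  rw [← lintegral_add_left hB]
  exact lintegral_mono fun x => lintegral_union_le _ _ _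

end pairIntegral

/-- The kernel `|x - y|^{-(n+s)}`. On the diagonal it takes the value `0`, since division by zero
is zero; this is harmless as the diagonal is a null set. -/
noncomputable def rieszKernel (s : ℝ) (x y : EuclideanSpace ℝ (Fin n)) : ℝ≥0∞ :=
  ENNReal.ofReal (1 / ‖x - y‖ ^ ((n : ℝ) + s))

theorem interaction_eq_pairIntegral (s : ℝ) (A B : Set (EuclideanSpace ℝ (Fin n))) :
    interaction s A B = pairIntegral (rieszKernel s) A B := rfl

theorem measurable_rieszKernel (s : ℝ) :
    Measurable (Function.uncurry (rieszKernel (n := n) s)) := by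
  unfold rieszKernel Function.uncurry
  fun_prop

theorem rieszKernel_comm (s : ℝ) (x y : EuclideanSpace ℝ (Fin n)) :
    rieszKernel s x y = rieszKernel s y x := by
  rw [rieszKernel, rieszKernel, norm_sub_rev]

/-! ### Removing a piece of a minimal set -/

/-- Comparing a minimal set `E` with `E \ A` for `A ⊆ E ∩ Ω`, all interactions cancel but those
of `A` with the complement of `E` and with the rest of `E`. -/
theorem IsSMinimal.interaction_le {s : ℝ} {Ω E A : Set (EuclideanSpace ℝ (Fin n))}
    (hE : IsSMinimal s Ω E) (hΩ : MeasurableSet Ω) (hA : NullMeasurableSet A volume)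
    (hAE : A ⊆ E ∩ Ω) :
    interaction s A Eᶜ < ∞ ∧ interaction s A Eᶜ ≤ interaction s A (E \ A) := by
  have hk := measurable_rieszKernel (n := n) s
  have hsymm := rieszKernel_comm (n := n) s
  have hEm := hE.measurable
  have hfin := hE.finite
  have hle := hE.le_competitor (E \ A) (hEm.diff hA) (by
    ext x; constructor
    · rintro ⟨⟨h1, -⟩, h2⟩; exact ⟨h1, h2⟩
    · rintro ⟨h1, h2⟩; exact ⟨⟨h1, fun h => h2 (hAE h).2⟩, h2⟩)
  have e1 : E ∩ Ω = ((E ∩ Ω) \ A) ∪ A := (sdiff_union_of_subset hAE).symm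
  have e2 : (E \ A) ∩ Ω = (E ∩ Ω) \ A := by ext; simp; tauto
  have e3 : (E \ A)ᶜ = Eᶜ ∪ A := by ext; simp; tauto
  have e4 : (E \ A) \ Ω = E \ Ω := by
    ext x; have := @hAE x; simp at this ⊢; tauto
  have e5 : Ω \ (E \ A) = (Ω \ E) ∪ A := by
    ext x; have := @hAE x; simp at this ⊢; tauto
  have e6 : E \ A = ((E ∩ Ω) \ A) ∪ (E \ Ω) := by
    ext x; have := @hAE x; simp at this ⊢; tauto
  have d1 : AEDisjoint volume ((E ∩ Ω) \ A) A := disjoint_sdiff_left.aedisjoint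
  have d2 : AEDisjoint volume Eᶜ A :=
    (disjoint_left.2 fun x (hx : x ∉ E) hxA => hx (hAE hxA).1).aedisjoint
  have d3 : AEDisjoint volume (Ω \ E) A :=
    (disjoint_left.2 fun x hx hxA => hx.2 (hAE hxA).1).aedisjoint
  have d4 : AEDisjoint volume ((E ∩ Ω) \ A) (E \ Ω) :=
    (disjoint_left.2 fun x hx hxA => hxA.2 hx.1.2).aedisjoint
  simp only [fracPerimeter, interaction_eq_pairIntegral] at hfin hle ⊢
  rw [e2, e3, e4, e5, pairIntegral_union_right hk d2 hA, pairIntegral_union_right hk d3 hA] at hle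
  have e7 : pairIntegral (rieszKernel s) (E ∩ Ω) Eᶜ =
      pairIntegral (rieszKernel s) ((E ∩ Ω) \ A) Eᶜ + pairIntegral (rieszKernel s) A Eᶜ := by
    rw [← pairIntegral_union_left d1 hA, ← e1]
  rw [e7] at hfin hle
  rw [pairIntegral_comm hk hsymm A (E \ A), e6,
    pairIntegral_union_left d4 (hEm.diff hΩ.nullMeasurableSet)]
  set a := pairIntegral (rieszKernel s) ((E ∩ Ω) \ A) Eᶜ
  set b := pairIntegral (rieszKernel s) A Eᶜ
  set c := pairIntegral (rieszKernel s) (E \ Ω) (Ω \ E)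
  set d := pairIntegral (rieszKernel s) ((E ∩ Ω) \ A) A
  set e := pairIntegral (rieszKernel s) (E \ Ω) A
  have hac : a + c ≠ ∞ := by
    refine ne_top_of_le_ne_top hfin.ne ?_
    gcongr
    exact le_self_add
  refine ⟨lt_of_le_of_lt (le_trans le_add_self le_self_add) hfin, ?_⟩
  refine (ENNReal.add_le_add_iff_left hac).1 ?_
  calc a + c + b = a + b + c := by ring
    _ ≤ a + d + (c + e) := hle
    _ = a + c + (d + e) := by ring


/-! ### Integrability of the kernel near a hyperplane -/

theorem volume_slab_le {v : EuclideanSpace ℝ (Fin n)} (hv : v ≠ 0) {t w : ℝ} :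
    volume {h : EuclideanSpace ℝ (Fin n) | ‖h‖ ≤ t ∧ |inner ℝ v h| ≤ w} ≤
      ENNReal.ofReal (2 * (w / ‖v‖)) * ENNReal.ofReal (2 * t) ^ (n - 1) := by
  have hv' : 0 < ‖v‖ := norm_pos_iff.2 hv
  obtain ⟨i₀⟩ : Nonempty (Fin n) := by
    by_contra hne
    rw [not_nonempty_iff] at hne
    exact hv (Subsingleton.elim _ _)
  have hon : Orthonormal ℝ
      (({i₀} : Set (Fin n)).domRestrict fun _ : Fin n => (‖v‖⁻¹ : ℝ) • v) := by
    constructor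
    · rintro ⟨i, hi⟩
      simp [norm_smul, hv'.ne']
    · rintro ⟨i, hi⟩ ⟨j, hj⟩ hij
      rw [mem_singleton_iff] at hi hj
      subst hi; subst hj
      exact absurd rfl hij
  obtain ⟨b, hb⟩ := hon.exists_orthonormalBasis_extension_of_card_eq (by simp)
  have hb0 : b i₀ = (‖v‖⁻¹ : ℝ) • v := hb i₀ rfl
  let box : Set (Fin n → ℝ) :=
    Set.pi univ fun i => if i = i₀ then Icc (-(w / ‖v‖)) (w / ‖v‖) else Icc (-t) t
  have hmp : MeasurePreserving (fun h : EuclideanSpace ℝ (Fin n) => WithLp.ofLp (b.repr h))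
      volume volume :=
    (PiLp.volume_preserving_ofLp (Fin n)).comp b.measurePreserving_repr
  have hbox : MeasurableSet box := by
    refine MeasurableSet.univ_pi fun i => ?_
    split_ifs <;> exact measurableSet_Icc
  have hsub : {h : EuclideanSpace ℝ (Fin n) | ‖h‖ ≤ t ∧ |inner ℝ v h| ≤ w} ⊆
      (fun h : EuclideanSpace ℝ (Fin n) => WithLp.ofLp (b.repr h)) ⁻¹' box := by
    rintro h ⟨ht, hw⟩ i -
    have hi : WithLp.ofLp (b.repr h) i = inner ℝ (b i) h := b.repr_apply_apply h i
    simp only [hi]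
    split_ifs with hii
    · rw [hii, hb0, real_inner_smul_left, mem_Icc, ← abs_le, abs_mul, abs_inv, abs_norm,
        inv_mul_eq_div]
      gcongr
    · rw [mem_Icc, ← abs_le]
      refine (abs_real_inner_le_norm _ _).trans ?_
      simpa using ht
  refine (measure_mono hsub).trans ?_
  rw [hmp.measure_preimage hbox.nullMeasurableSet, volume_pi_pi,
    ← Finset.mul_prod_erase _ _ (Finset.mem_univ i₀)]
  refine mul_le_mul' (le_of_eq ?_) (le_of_eq ?_)
  · rw [if_pos rfl, Real.volume_Icc]; congr 1; ring
  · rw [Finset.prod_congr rfl (g := fun _ => ENNReal.ofReal (2 * t)), Finset.prod_const,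
      Finset.card_erase_of_mem (Finset.mem_univ _), Finset.card_univ, Fintype.card_fin]
    intro i hi
    rw [if_neg (Finset.ne_of_mem_erase hi), Real.volume_Icc]; congr 1; ring

/-- The complement of the two open balls with centres `v` and `-v` that touch at the origin. For
`v = x - c`, it consists of all `h` such that neither `x + h` nor `x - h` lies in the open ball with
centre `c` whose boundary sphere passes through `x`. -/
def tangentRegion (v : EuclideanSpace ℝ (Fin n)) : Set (EuclideanSpace ℝ (Fin n)) :=
  {h | |inner ℝ v h| ≤ ‖h‖ ^ 2 / 2}

theorem volume_tangentRegion_inter_le {v : EuclideanSpace ℝ (Fin n)} {δ t : ℝ} (hδ : 0 < δ)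
    (hv : δ ≤ ‖v‖) (ht : 0 < t) :
    volume (tangentRegion v ∩ closedBall 0 t) ≤ ENNReal.ofReal (2 ^ n / δ * t ^ (n + 1)) := by
  have hv0 : 0 < ‖v‖ := hδ.trans_le hv
  rcases n with _ | n
  · exact absurd (Subsingleton.elim v 0) (norm_pos_iff.1 hv0)
  have hsub : tangentRegion v ∩ closedBall 0 t ⊆
      {h : EuclideanSpace ℝ (Fin (n + 1)) | ‖h‖ ≤ t ∧ |inner ℝ v h| ≤ t ^ 2 / 2} := by
    rintro h ⟨h1, h2⟩
    rw [mem_closedBall_zero_iff] at h2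
    refine ⟨h2, le_trans h1 ?_⟩
    gcongr
  refine ((measure_mono hsub).trans (volume_slab_le (norm_pos_iff.1 hv0))).trans ?_
  rw [← ENNReal.ofReal_pow (by positivity), ← ENNReal.ofReal_mul (by positivity)]
  apply ENNReal.ofReal_le_ofReal
  calc 2 * (t ^ 2 / 2 / ‖v‖) * (2 * t) ^ (n + 1 - 1) = 2 ^ n * t ^ (n + 1 + 1) / ‖v‖ := by
        rw [Nat.add_sub_cancel, mul_pow]; field_simp; ring
    _ ≤ 2 ^ (n + 1) * t ^ (n + 1 + 1) / δ := by
        gcongr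
        · norm_num
        · omega
    _ = _ := by ring

/-- The kernel `|h|^{-(n+1/2)}` is integrable near the origin on any set whose measure in the ball
of radius `t` decays like `t^{n+1}`: sum over dyadic annuli. -/
theorem exists_lintegral_rpow_le (n : ℕ) (C τ : ℝ) (hτ : 0 < τ) :
    ∃ Q : ℝ≥0∞, Q ≠ ∞ ∧ ∀ S : Set (EuclideanSpace ℝ (Fin n)),
      (∀ t : ℝ, 0 < t → volume (S ∩ closedBall 0 t) ≤ ENNReal.ofReal (C * t ^ (n + 1))) →
      ∫⁻ h in S ∩ closedBall 0 τ, ENNReal.ofReal (1 / ‖h‖ ^ ((n : ℝ) + 1 / 2)) ≤ Q := by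
  let q : ℝ := (1 / 2 : ℝ) ^ (1 / 2 : ℝ)
  have hq0 : 0 ≤ q := by positivity
  have hq1 : q < 1 := Real.rpow_lt_one (by norm_num) (by norm_num) (by norm_num)
  let D : ℝ := C * 2 ^ ((n : ℝ) + 1 / 2) * τ ^ (1 / 2 : ℝ)
  refine ⟨∑' k : ℕ, ENNReal.ofReal (D * q ^ k),
    ((summable_geometric_of_lt_one hq0 hq1).mul_left D).tsum_ofReal_ne_top, fun S hS => ?_⟩
  let r : ℕ → ℝ := fun k => τ * (1 / 2) ^ k
  have hr : ∀ k, 0 < r k := fun k => by positivity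
  let annulus : ℕ → Set (EuclideanSpace ℝ (Fin n)) := fun k =>
    (S ∩ closedBall 0 (r k)) ∩ {h | r k / 2 ≤ ‖h‖}
  have hcover : S ∩ closedBall 0 τ ⊆ {0} ∪ ⋃ k, annulus k := by
    rintro h ⟨hS, hh⟩
    rw [mem_closedBall_zero_iff] at hh
    rcases eq_or_ne h 0 with rfl | h0
    · exact Or.inl rfl
    right
    have hpos : 0 < ‖h‖ := norm_pos_iff.2 h0
    obtain ⟨k, hk1, hk2⟩ := exists_nat_pow_near_of_lt_one (x := ‖h‖ / τ) (y := 1 / 2)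
      (by positivity) ((div_le_one hτ).2 hh) (by norm_num) (by norm_num)
    refine mem_iUnion.2 ⟨k, ⟨hS, ?_⟩, ?_⟩
    · rw [mem_closedBall_zero_iff]
      rw [div_le_iff₀ hτ] at hk2
      exact hk2.trans_eq (mul_comm _ _)
    · rw [lt_div_iff₀ hτ] at hk1
      refine le_trans (le_of_eq ?_) hk1.le
      simp only [r, pow_succ]; ring
  refine (lintegral_mono_set hcover).trans ((lintegral_union_le _ _ _).trans ?_)
  have h0 : ∫⁻ h in ({0} : Set (EuclideanSpace ℝ (Fin n))),
      ENNReal.ofReal (1 / ‖h‖ ^ ((n : ℝ) + 1 / 2)) = 0 := by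
    rw [lintegral_singleton, norm_zero, Real.zero_rpow (by positivity)]
    simp
  rw [h0, zero_add]
  refine (lintegral_iUnion_le _ _).trans (ENNReal.tsum_le_tsum fun k => ?_)
  calc ∫⁻ h in annulus k, ENNReal.ofReal (1 / ‖h‖ ^ ((n : ℝ) + 1 / 2))
      ≤ ∫⁻ h in annulus k, ENNReal.ofReal (1 / (r k / 2) ^ ((n : ℝ) + 1 / 2)) := by
        refine lintegral_mono_ae ?_
        have : ∀ᵐ h ∂volume.restrict (annulus k), h ∈ {h | r k / 2 ≤ ‖h‖} :=
          ae_mono (Measure.restrict_mono inter_subset_right le_rfl)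
            (ae_restrict_mem (measurableSet_le measurable_const measurable_norm))
        filter_upwards [this] with h hh
        have := hr k
        have hh : r k / 2 ≤ ‖h‖ := hh
        gcongr
    _ = ENNReal.ofReal (1 / (r k / 2) ^ ((n : ℝ) + 1 / 2)) * volume (annulus k) :=
        setLIntegral_const _ _
    _ ≤ ENNReal.ofReal (1 / (r k / 2) ^ ((n : ℝ) + 1 / 2)) *
          ENNReal.ofReal (C * r k ^ (n + 1)) := by
        gcongr
        exact (measure_mono inter_subset_left).trans (hS _ (hr k))
    _ = ENNReal.ofReal (D * q ^ k) := by
        rw [← ENNReal.ofReal_mul (by have := hr k; positivity)]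
        congr 1
        have e1 : r k ^ (n + 1) = r k ^ ((n : ℝ) + 1 / 2) * r k ^ (1 / 2 : ℝ) := by
          rw [← Real.rpow_add (hr k), ← Real.rpow_natCast]; congr 1; push_cast; ring
        have e2 : r k ^ (1 / 2 : ℝ) = τ ^ (1 / 2 : ℝ) * q ^ k := by
          simp only [r, q]
          rw [Real.mul_rpow hτ.le (by positivity), ← Real.rpow_natCast, ← Real.rpow_natCast,
            ← Real.rpow_mul (by norm_num), ← Real.rpow_mul (by norm_num), mul_comm (k : ℝ)]
        have h1 : 0 < r k ^ ((n : ℝ) + 1 / 2) := Real.rpow_pos_of_pos (hr k) _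
        rw [Real.div_rpow (hr k).le (by norm_num), e1, e2]
        simp only [D]
        generalize r k ^ ((n : ℝ) + 1 / 2) = X at h1 ⊢
        generalize (2 : ℝ) ^ ((n : ℝ) + 1 / 2) = Y
        field_simp

/-- The bound behind the calibration: the kernel is integrable on the tangent regions, uniformly
in `s ≤ 1/2` and in the (not too small) radius of the spheres. -/
theorem exists_lintegral_tangentRegion_le (n : ℕ) {δ τ : ℝ} (hδ : 0 < δ) (hτ : 1 ≤ τ) :
    ∃ Q : ℝ≥0∞, Q ≠ ∞ ∧ ∀ s ∈ Ioc (0 : ℝ) (1 / 2), ∀ v : EuclideanSpace ℝ (Fin n), δ ≤ ‖v‖ →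
      ∫⁻ h in tangentRegion v ∩ closedBall 0 τ, ENNReal.ofReal (1 / ‖h‖ ^ ((n : ℝ) + s)) ≤ Q := by
  have hτ0 : 0 < τ := by linarith
  obtain ⟨Q, hQ, h⟩ := exists_lintegral_rpow_le n (2 ^ n / δ) τ hτ0
  refine ⟨ENNReal.ofReal τ * Q, ENNReal.mul_ne_top ENNReal.ofReal_ne_top hQ,
    fun s hs v hv => ?_⟩
  refine le_trans ?_ (mul_le_mul_right
    (h (tangentRegion v) fun t ht => volume_tangentRegion_inter_le hδ hv ht) _)
  rw [← lintegral_const_mul _ (by fun_prop)]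
  refine lintegral_mono_ae ?_
  have : ∀ᵐ h ∂volume.restrict (tangentRegion v ∩ closedBall 0 τ),
      h ∈ closedBall (0 : EuclideanSpace ℝ (Fin n)) τ :=
    ae_mono (Measure.restrict_mono inter_subset_right le_rfl)
      (ae_restrict_mem measurableSet_closedBall)
  filter_upwards [this] with h hh
  rw [mem_closedBall_zero_iff] at hh
  rw [← ENNReal.ofReal_mul hτ0.le]
  apply ENNReal.ofReal_le_ofReal
  have hs0 := hs.1
  rcases (norm_nonneg h).eq_or_lt with h0 | h0
  · rw [← h0, Real.zero_rpow (by positivity), Real.zero_rpow (by positivity)]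
    simp
  have h1 : ‖h‖ ^ ((n : ℝ) + 1 / 2) ≤ ‖h‖ ^ ((n : ℝ) + s) * τ := by
    rw [show (n : ℝ) + 1 / 2 = (n + s) + (1 / 2 - s) by ring, Real.rpow_add h0]
    gcongr
    have hs2 : 0 ≤ 1 / 2 - s := by linarith [hs.2]
    calc ‖h‖ ^ (1 / 2 - s) ≤ τ ^ (1 / 2 - s) := by gcongr
      _ ≤ τ ^ (1 : ℝ) := Real.rpow_le_rpow_of_exponent_le hτ (by linarith)
      _ = τ := Real.rpow_one τ
  rw [mul_one_div, div_le_div_iff₀ (by positivity) (by positivity)]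
  linarith


/-! ### Calibration by concentric balls -/

/-- The kernel `|x - y|^{-(n+s)}` truncated at height `m`. -/
noncomputable def truncKernel (s : ℝ) (m : ℕ) (x y : EuclideanSpace ℝ (Fin n)) : ℝ≥0∞ :=
  min (rieszKernel s x y) m

theorem measurable_truncKernel (s : ℝ) (m : ℕ) :
    Measurable (Function.uncurry (truncKernel (n := n) s m)) :=
  (measurable_rieszKernel s).min measurable_const

theorem truncKernel_comm (s : ℝ) (m : ℕ) (x y : EuclideanSpace ℝ (Fin n)) :
    truncKernel s m x y = truncKernel s m y x := by
  rw [truncKernel, truncKernel, rieszKernel_comm]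

theorem iSup_truncKernel (s : ℝ) (x y : EuclideanSpace ℝ (Fin n)) :
    ⨆ m : ℕ, truncKernel s m x y = rieszKernel s x y := by
  refine le_antisymm (iSup_le fun m => min_le_left _ _) ?_
  obtain ⟨m, hm⟩ := ENNReal.exists_nat_gt (r := rieszKernel s x y) ENNReal.ofReal_ne_top
  exact le_iSup_of_le m (le_min le_rfl hm.le)

theorem pairIntegral_rieszKernel_eq_iSup (s : ℝ) (A B : Set (EuclideanSpace ℝ (Fin n))) :
    pairIntegral (rieszKernel s) A B = ⨆ m : ℕ, pairIntegral (truncKernel s m) A B := by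
  have hmono : Monotone fun (m : ℕ) (x y : EuclideanSpace ℝ (Fin n)) => truncKernel s m x y := by
    intro m m' hm x y
    exact min_le_min le_rfl (by exact_mod_cast hm)
  unfold pairIntegral
  rw [← lintegral_iSup]
  · refine lintegral_congr fun x => ?_
    rw [← lintegral_iSup]
    · simp_rw [iSup_truncKernel]
    · exact fun m => (measurable_truncKernel s m).of_uncurry_left
    · exact fun m m' hm y => hmono hm x y
  · exact fun m => (measurable_truncKernel s m).lintegral_prod_right'
  · exact fun m m' hm x => lintegral_mono fun y => hmono hm x y

/-- One-sided bound for the nonlocal mean curvature at `x` of the ball with centre `c` through `x`.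
The reflection `y ↦ 2x - y` maps the exterior of the ball into the ball, up to a translate of the
tangent region. -/
theorem lintegral_truncKernel_exterior_le (s : ℝ) (m : ℕ) (c x : EuclideanSpace ℝ (Fin n))
    {τ : ℝ} (hx : ‖x - c‖ < τ) :
    ∫⁻ y in ball c τ ∩ {y | ‖x - c‖ < ‖y - c‖}, truncKernel s m x y ≤
      (∫⁻ y in ball c ‖x - c‖, truncKernel s m x y) +
        ∫⁻ h in tangentRegion (x - c) ∩ closedBall 0 (2 * τ),
          ENNReal.ofReal (1 / ‖h‖ ^ ((n : ℝ) + s)) := by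
  have hrefl : MeasurePreserving (fun y : EuclideanSpace ℝ (Fin n) => (x + x) - y)
      volume volume := Measure.measurePreserving_sub_left volume (x + x)
  have htrans : MeasurePreserving (fun y : EuclideanSpace ℝ (Fin n) => y - x)
      volume volume := measurePreserving_sub_right volume x
  have hcover : ball c τ ∩ {y | ‖x - c‖ < ‖y - c‖} ⊆
      ((fun y => (x + x) - y) ⁻¹' ball c ‖x - c‖) ∪
        ((fun y => y - x) ⁻¹' (tangentRegion (x - c) ∩ closedBall 0 (2 * τ))) := by
    rintro y ⟨hy1, hy2⟩
    have hy2 : ‖x - c‖ < ‖y - c‖ := hy2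
    by_cases hy : y ∈ (fun y => (x + x) - y) ⁻¹' ball c ‖x - c‖
    · exact Or.inl hy
    right
    rw [mem_preimage, mem_ball_iff_norm, not_lt] at hy
    rw [mem_ball_iff_norm] at hy1
    have e1 : y - c = (x - c) + (y - x) := by abel
    have e2 : x + x - y - c = (x - c) - (y - x) := by abel
    rw [e1] at hy2
    rw [e2] at hy
    have h1 : ‖x - c‖ ^ 2 < ‖(x - c) + (y - x)‖ ^ 2 := by gcongr
    have h2 : ‖x - c‖ ^ 2 ≤ ‖(x - c) - (y - x)‖ ^ 2 := by gcongr
    rw [norm_add_sq_real] at h1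
    rw [norm_sub_sq_real (x - c)] at h2
    refine ⟨?_, ?_⟩
    · show |inner ℝ (x - c) (y - x)| ≤ ‖y - x‖ ^ 2 / 2
      rw [abs_le]
      constructor <;> linarith
    · rw [mem_closedBall_zero_iff]
      have : ‖y - x‖ ≤ ‖y - c‖ + ‖x - c‖ := by
        rw [← sub_sub_sub_cancel_right y x c]; exact norm_sub_le _ _
      linarith
  refine (lintegral_mono_set hcover).trans ((lintegral_union_le _ _ _).trans ?_)
  refine add_le_add (le_of_eq ?_) ?_
  · rw [← hrefl.setLIntegral_comp_preimage measurableSet_ball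
      (measurable_truncKernel s m).of_uncurry_left]
    refine lintegral_congr fun y => ?_
    rw [truncKernel, truncKernel, rieszKernel, rieszKernel, ← norm_neg (x - y)]
    congr 6; abel
  · have hme : MeasurableEmbedding fun y : EuclideanSpace ℝ (Fin n) => y - x :=
      (MeasurableEquiv.subRight x).measurableEmbedding
    rw [← htrans.setLIntegral_comp_preimage_emb hme
      (fun h => ENNReal.ofReal (1 / ‖h‖ ^ ((n : ℝ) + s)))]
    refine lintegral_mono fun y => (min_le_left _ _).trans (le_of_eq ?_)
    rw [rieszKernel, norm_sub_rev]

/-- Balls are almost minimal under removal of a set `A` away from the centre, with an error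
proportional to the volume of `A`. The spheres concentric with the ball calibrate it:
points of `A × A` contribute nothing by antisymmetry, and what remains is the integral over `A` of
the nonlocal mean curvatures of these spheres. -/
theorem exists_interaction_le_of_subset_ball (n : ℕ) {δ τ : ℝ} (hδ : 0 < δ) (hτ : 1 ≤ τ) :
    ∃ Q : ℝ≥0∞, Q ≠ ∞ ∧ ∀ s ∈ Ioc (0 : ℝ) (1 / 2), ∀ r < τ, ∀ c : EuclideanSpace ℝ (Fin n),
      ∀ A : Set (EuclideanSpace ℝ (Fin n)), NullMeasurableSet A volume →
        A ⊆ ball c r \ ball c δ →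
        interaction s A (ball c τ \ ball c r) ≤
          interaction s A (ball c r \ A) + Q * volume A := by
  obtain ⟨Q, hQ, hbound⟩ := exists_lintegral_tangentRegion_le n hδ
    (show (1 : ℝ) ≤ 2 * τ by linarith)
  refine ⟨Q, hQ, fun s hs r hr c A hA hAr => ?_⟩
  rw [interaction_eq_pairIntegral, interaction_eq_pairIntegral, pairIntegral_rieszKernel_eq_iSup]
  refine iSup_le fun m => ?_
  have hAfin : volume A ≠ ∞ :=
    measure_ne_top_of_subset (hAr.trans sdiff_subset) measure_ball_lt_top.ne
  have hk := measurable_truncKernel (n := n) s m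
  -- interactions within `A` with the points farther from, or closer to, the centre
  let far : ℝ≥0∞ := ∫⁻ x in A, ∫⁻ y in A, {y | ‖x - c‖ < ‖y - c‖}.indicator (truncKernel s m x) y
  let near : ℝ≥0∞ := ∫⁻ x in A, ∫⁻ y in A, {y | ‖y - c‖ < ‖x - c‖}.indicator (truncKernel s m x) y
  have hset : MeasurableSet
      {p : EuclideanSpace ℝ (Fin n) × EuclideanSpace ℝ (Fin n) | ‖p.1 - c‖ < ‖p.2 - c‖} :=
    measurableSet_lt (by fun_prop) (by fun_prop)
  have hmeas : Measurable (Function.uncurry fun x y : EuclideanSpace ℝ (Fin n) =>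
      {y | ‖x - c‖ < ‖y - c‖}.indicator (truncKernel s m x) y) := by
    exact hk.indicator hset
  have hswap : far = near := by
    simp only [far, near]
    rw [lintegral_lintegral_swap hmeas.aemeasurable]
    refine lintegral_congr fun x => lintegral_congr fun y => ?_
    simp only [indicator, mem_ofPred_eq, truncKernel_comm s m x y]
  have hfar : far ≠ ∞ := by
    have : far ≤ ∫⁻ x in A, ∫⁻ y in A, (m : ℝ≥0∞) := by
      refine lintegral_mono fun x => lintegral_mono fun y => ?_
      exact (indicator_le_self _ _ _).trans (min_le_right _ _)
    refine ne_top_of_le_ne_top ?_ this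
    simp only [setLIntegral_const]
    finiteness
  -- the curvature bound at each point of `A`, with the domains of integration split along `A`
  have hpt : ∀ x ∈ A, (∫⁻ y in ball c τ \ ball c r, truncKernel s m x y) +
      ∫⁻ y in A, {y | ‖x - c‖ < ‖y - c‖}.indicator (truncKernel s m x) y ≤
      ((∫⁻ y in ball c r \ A, truncKernel s m x y) +
        ∫⁻ y in A, {y | ‖y - c‖ < ‖x - c‖}.indicator (truncKernel s m x) y) + Q := by
    intro x hx
    have hxr : ‖x - c‖ < r := mem_ball_iff_norm.1 (hAr hx).1
    have hxδ : δ ≤ ‖x - c‖ := not_lt.1 fun h => (hAr hx).2 (mem_ball_iff_norm.2 h)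
    have hP : MeasurableSet {y : EuclideanSpace ℝ (Fin n) | ‖x - c‖ < ‖y - c‖} :=
      measurableSet_lt (by fun_prop) (by fun_prop)
    have hN : MeasurableSet {y : EuclideanSpace ℝ (Fin n) | ‖y - c‖ < ‖x - c‖} :=
      measurableSet_lt (by fun_prop) (by fun_prop)
    rw [setLIntegral_indicator hP, setLIntegral_indicator hN]
    calc _ = ∫⁻ y in (ball c τ \ ball c r) ∪ ({y | ‖x - c‖ < ‖y - c‖} ∩ A),
            truncKernel s m x y := by
          rw [Measure.restrict_union₀ _ (hP.nullMeasurableSet.inter hA), lintegral_add_measure]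
          exact (disjoint_left.2 fun y hy hy' => hy.2 (hAr hy'.2).1).aedisjoint
      _ ≤ ∫⁻ y in ball c τ ∩ {y | ‖x - c‖ < ‖y - c‖}, truncKernel s m x y := by
          refine lintegral_mono_set ?_
          rintro y (⟨hy1, hy2⟩ | ⟨hy1, hy2⟩)
          · rw [mem_ball_iff_norm, not_lt] at hy2
            exact ⟨hy1, hxr.trans_le hy2⟩
          · exact ⟨ball_subset_ball hr.le (hAr hy2).1, hy1⟩
      _ ≤ (∫⁻ y in ball c ‖x - c‖, truncKernel s m x y) + Q :=
          (lintegral_truncKernel_exterior_le s m c x (hxr.trans hr)).trans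
            (add_le_add le_rfl (hbound s hs _ hxδ))
      _ ≤ _ := by
          refine add_le_add ?_ le_rfl
          refine (lintegral_mono_set ?_).trans (lintegral_union_le _ _ _)
          intro y hy
          rw [mem_ball_iff_norm] at hy
          by_cases hyA : y ∈ A
          · exact Or.inr ⟨hy, hyA⟩
          · exact Or.inl ⟨mem_ball_iff_norm.2 (hy.trans hxr), hyA⟩
  have hinner : ∀ B : Set (EuclideanSpace ℝ (Fin n)),
      Measurable fun x => ∫⁻ y in B, truncKernel s m x y := fun B => hk.lintegral_prod_right'
  have hint : pairIntegral (truncKernel s m) A (ball c τ \ ball c r) + far ≤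
      pairIntegral (truncKernel s m) A (ball c r \ A) + near + Q * volume A := by
    simp only [pairIntegral, far, near]
    rw [← lintegral_add_left (hinner _), ← lintegral_add_left (hinner _), ← setLIntegral_const, ← lintegral_add_right _ measurable_const]
    exact lintegral_mono_ae ((ae_restrict_mem₀ hA).mono hpt)
  rw [← hswap, add_right_comm] at hint
  refine ((ENNReal.add_le_add_iff_right hfar).1 hint).trans ?_
  refine add_le_add ?_ le_rfl
  exact lintegral_mono fun x => lintegral_mono fun y => min_le_left _ _


/-! ### The contribution from infinity -/

theorem sphereArea_ne_top (n : ℕ) : sphereArea n ≠ ∞ := by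
  rw [sphereArea_eq]
  exact ENNReal.mul_ne_top (ENNReal.natCast_ne_top n) measure_ball_lt_top.ne

theorem lintegral_compl_ball_rpow (hn : n ≠ 0) {s T : ℝ} (hs : 0 < s) (hT : 0 < T) :
    ∫⁻ y in (ball (0 : EuclideanSpace ℝ (Fin n)) T)ᶜ, ENNReal.ofReal (1 / ‖y‖ ^ ((n : ℝ) + s)) =
      ENNReal.ofReal ((sphereArea n).toReal * T ^ (-s) / s) := by
  have : Nonempty (Fin n) := ⟨⟨0, Nat.pos_of_ne_zero hn⟩⟩
  let f : ℝ → ℝ := (Ici T).indicator fun t => 1 / t ^ ((n : ℝ) + s)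
  have hf0 : ∀ t, 0 ≤ f t := fun t => indicator_nonneg (fun t ht => by
    have : 0 < t := hT.trans_le ht
    positivity) t
  have hmul : ∀ t ∈ Ioi (0 : ℝ),
      t ^ (n - 1) • f t = (Ici T).indicator (fun t => t ^ (-1 - s)) t := by
    intro t ht
    have ht : 0 < t := ht
    by_cases htT : t ∈ Ici T
    · simp only [f, indicator_of_mem htT, smul_eq_mul]
      rw [one_div, ← Real.rpow_neg ht.le, ← Real.rpow_natCast, ← Real.rpow_add ht]
      congr 1
      rw [Nat.cast_sub (Nat.one_le_iff_ne_zero.2 hn)]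
      push_cast; ring
    · simp [f, indicator_of_notMem htT]
  have hIoi : Ioi (0 : ℝ) ∩ Ici T = Ici T :=
    inter_eq_right.2 fun t ht => hT.trans_le ht
  have hint : Integrable (fun y : EuclideanSpace ℝ (Fin n) => f ‖y‖) volume := by
    rw [integrable_fun_norm_addHaar, finrank_euclideanSpace_fin,
      integrableOn_congr_fun hmul measurableSet_Ioi, IntegrableOn,
      integrable_indicator_iff measurableSet_Ici, IntegrableOn,
      Measure.restrict_restrict measurableSet_Ici, inter_comm, hIoi, ← IntegrableOn,
      integrableOn_Ici_iff_integrableOn_Ioi]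
    exact integrableOn_Ioi_rpow_of_lt (by linarith) hT
  have hval : ∫ y : EuclideanSpace ℝ (Fin n), f ‖y‖ =
      (sphereArea n).toReal * T ^ (-s) / s := by
    rw [integral_fun_norm_addHaar, finrank_euclideanSpace_fin,
      setIntegral_congr_fun measurableSet_Ioi hmul, setIntegral_indicator measurableSet_Ici, hIoi,
      integral_Ici_eq_integral_Ioi, integral_Ioi_rpow_of_lt (by linarith) hT, sphereArea_eq,
      ENNReal.toReal_mul, ENNReal.toReal_natCast, nsmul_eq_mul, smul_eq_mul, Measure.real,
      show -1 - s + 1 = -s by ring, neg_div_neg_eq]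
    ring
  rw [← hval, ofReal_integral_eq_lintegral_ofReal hint (Eventually.of_forall fun y => hf0 _),
    ← lintegral_indicator measurableSet_ball.compl]
  refine lintegral_congr fun y => ?_
  by_cases hy : T ≤ ‖y‖
  · rw [indicator_of_mem (by simpa using hy)]
    simp only [f, indicator_of_mem (show ‖y‖ ∈ Ici T from hy)]
  · rw [indicator_of_notMem (by simpa using hy)]
    simp only [f, indicator_of_notMem (show ‖y‖ ∉ Ici T from hy), ENNReal.ofReal_zero]

/-- If `x` stays bounded, then `|x - y|` and `|y|` are comparable for large `y`, with constants
near `1`. -/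
theorem rieszKernel_le_and_ge {M t T s : ℝ} (hM : 0 < M) (ht : 1 < t) (hT : t * M / (t - 1) ≤ T)
    (hs : s ∈ Ioc (0 : ℝ) 1) {x y : EuclideanSpace ℝ (Fin n)} (hx : ‖x‖ ≤ M) (hy : T ≤ ‖y‖) :
    rieszKernel s x y ≤ ENNReal.ofReal (t ^ (n + 1)) *
        ENNReal.ofReal (1 / ‖y‖ ^ ((n : ℝ) + s)) ∧
      ENNReal.ofReal ((t ^ (n + 1))⁻¹) * ENNReal.ofReal (1 / ‖y‖ ^ ((n : ℝ) + s)) ≤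
        rieszKernel s x y := by
  have ht0 : 0 < t := by linarith
  have ht1 : 0 < t - 1 := by linarith
  have hs0 := hs.1
  have hT0 : 0 < T := lt_of_lt_of_le (by positivity) hT
  have hy0 : 0 < ‖y‖ := hT0.trans_le hy
  have hk : t * M ≤ (t - 1) * ‖y‖ := by
    rw [div_le_iff₀ ht1] at hT
    nlinarith
  have h1 : ‖y‖ ≤ t * ‖x - y‖ := by
    have : ‖y‖ ≤ ‖x‖ + ‖x - y‖ := by
      rw [norm_sub_rev]; exact norm_le_norm_add_norm_sub' y x
    nlinarith
  have h2 : ‖x - y‖ ≤ t * ‖y‖ := by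
    have : ‖x - y‖ ≤ ‖x‖ + ‖y‖ := norm_sub_le x y
    nlinarith
  have hxy : 0 < ‖x - y‖ := by
    by_contra h
    have : t * ‖x - y‖ ≤ 0 := mul_nonpos_of_nonneg_of_nonpos ht0.le (not_lt.1 h)
    linarith
  have htp : t ^ ((n : ℝ) + s) ≤ t ^ (n + 1) := by
    rw [← Real.rpow_natCast]
    apply Real.rpow_le_rpow_of_exponent_le ht.le
    push_cast; linarith [hs.2]
  have hp1 : ‖y‖ ^ ((n : ℝ) + s) ≤ t ^ (n + 1) * ‖x - y‖ ^ ((n : ℝ) + s) := by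
    calc ‖y‖ ^ ((n : ℝ) + s) ≤ (t * ‖x - y‖) ^ ((n : ℝ) + s) := by gcongr
      _ = t ^ ((n : ℝ) + s) * ‖x - y‖ ^ ((n : ℝ) + s) := Real.mul_rpow ht0.le hxy.le
      _ ≤ _ := by gcongr
  have hp2 : ‖x - y‖ ^ ((n : ℝ) + s) ≤ t ^ (n + 1) * ‖y‖ ^ ((n : ℝ) + s) := by
    calc ‖x - y‖ ^ ((n : ℝ) + s) ≤ (t * ‖y‖) ^ ((n : ℝ) + s) := by gcongr
      _ = t ^ ((n : ℝ) + s) * ‖y‖ ^ ((n : ℝ) + s) := Real.mul_rpow ht0.le hy0.le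
      _ ≤ _ := by gcongr
  have hyp : 0 < ‖y‖ ^ ((n : ℝ) + s) := Real.rpow_pos_of_pos hy0 _
  have hxp : 0 < ‖x - y‖ ^ ((n : ℝ) + s) := Real.rpow_pos_of_pos hxy _
  have htn : 0 < t ^ (n + 1) := by positivity
  constructor
  · rw [rieszKernel, ← ENNReal.ofReal_mul htn.le]
    apply ENNReal.ofReal_le_ofReal
    rw [mul_one_div, div_le_div_iff₀ hxp hyp]
    linarith
  · rw [rieszKernel, ← ENNReal.ofReal_mul (inv_pos.2 htn).le]
    apply ENNReal.ofReal_le_ofReal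
    rw [inv_mul_eq_div, div_div, div_le_div_iff₀ (by positivity) hxp]
    linarith

/-- For small `s`, a bounded point sees at infinity more of the complement of `E₀` than of `E₀`;
the difference blows up like `1 / s`. -/
theorem exists_eventually_far_le {E₀ : Set (EuclideanSpace ℝ (Fin n))}
    (hE₀ : NullMeasurableSet E₀ volume) (hα : upperAlpha E₀ < sphereArea n / 2) {M : ℝ}
    (hM : 0 < M) :
    ∃ T : ℝ, M ≤ T ∧ ∃ η : ℝ, 0 < η ∧ ∀ᶠ s in 𝓝[>] (0 : ℝ),
      ∀ x : EuclideanSpace ℝ (Fin n), ‖x‖ ≤ M →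
        (∫⁻ y in E₀ \ ball 0 T, rieszKernel s x y) + ENNReal.ofReal (η / s) ≤
          ∫⁻ y in E₀ᶜ \ ball 0 T, rieszKernel s x y := by
  have hn : n ≠ 0 := by
    rintro rfl
    rw [sphereArea_eq] at hα
    simp at hα
  obtain ⟨a, ha1, ha2⟩ := ENNReal.lt_iff_exists_nnreal_btwn.1 hα
  let ω : ℝ := (sphereArea n).toReal
  have hω : sphereArea n = ENNReal.ofReal ω := (ENNReal.ofReal_toReal (sphereArea_ne_top n)).symm
  have haω : 2 * (a : ℝ) < ω := by
    have h : (2 * a : ℝ≥0∞) < sphereArea n := by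
      rw [mul_comm]
      exact (ENNReal.lt_div_iff_mul_lt (Or.inl (by norm_num)) (Or.inl (by norm_num))).1 ha2
    have := (ENNReal.toReal_lt_toReal (by finiteness) (sphereArea_ne_top n)).2 h
    simpa using this
  let g : ℝ → ℝ := fun t => (t ^ (n + 1))⁻¹ * ω - (t ^ (n + 1) + (t ^ (n + 1))⁻¹) * a
  have hg : ContinuousAt g 1 := by
    have : (1 : ℝ) ^ (n + 1) ≠ 0 := by simp
    fun_prop (disch := assumption)
  have hg1 : 0 < g 1 := by simp only [g, one_pow, inv_one]; linarith
  obtain ⟨t, ht1, ht⟩ : ∃ t : ℝ, 0 < g t ∧ 1 < t :=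
    (((hg.eventually (lt_mem_nhds hg1)).filter_mono nhdsWithin_le_nhds).and
      (self_mem_nhdsWithin : Ioi (1 : ℝ) ∈ 𝓝[>] 1)).exists
  let L : ℝ := t ^ (n + 1)
  have hL : 0 < L := by positivity
  let T : ℝ := max (max M 1) (t * M / (t - 1))
  have hTM : M ≤ T := (le_max_left _ _).trans (le_max_left _ _)
  have hT1 : 1 ≤ T := (le_max_right _ _).trans (le_max_left _ _)
  have hT0 : 0 < T := by linarith
  refine ⟨T, hTM, g t / 2, by linarith, ?_⟩
  have hpow : ∀ᶠ s in 𝓝[>] (0 : ℝ), L⁻¹ * ω - g t / 2 < L⁻¹ * ω * T ^ (-s) := by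
    have hc : ContinuousAt (fun s : ℝ => L⁻¹ * ω * T ^ (-s)) 0 := by
      have : Continuous fun s : ℝ => T ^ (-s) :=
        Real.continuous_const_rpow hT0.ne' |>.comp continuous_neg
      exact (continuous_const.mul this).continuousAt
    refine (hc.eventually (lt_mem_nhds ?_)).filter_mono nhdsWithin_le_nhds
    simp only [neg_zero, Real.rpow_zero]
    linarith
  filter_upwards [eventually_lt_of_limsup_lt ha1, hpow, Ioc_mem_nhdsGT (zero_lt_one' ℝ)] with
    s hsa hsT hs x hx
  have hs0 : 0 < s := hs.1
  let J : Set (EuclideanSpace ℝ (Fin n)) → ℝ≥0∞ := fun S =>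
    ∫⁻ y in S \ ball 0 T, ENNReal.ofReal (1 / ‖y‖ ^ ((n : ℝ) + s))
  have hJsum : J E₀ + J E₀ᶜ = ENNReal.ofReal (ω * T ^ (-s) / s) := by
    rw [← lintegral_compl_ball_rpow hn hs0 hT0]
    have : (ball (0 : EuclideanSpace ℝ (Fin n)) T)ᶜ =
        (E₀ \ ball 0 T) ∪ (E₀ᶜ \ ball 0 T) := by
      rw [← union_sdiff_distrib, union_compl_self, compl_eq_univ_sdiff]
    rw [this, Measure.restrict_union₀ _ (hE₀.compl.diff measurableSet_ball.nullMeasurableSet),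
      lintegral_add_measure]
    exact (disjoint_left.2 fun y hy hy' => hy'.1 hy.1).aedisjoint
  have hJle : J E₀ ≤ ENNReal.ofReal (a / s) := by
    have h1 : J E₀ ≤ ∫⁻ y in E₀ \ ball 0 1, ENNReal.ofReal (1 / ‖y‖ ^ ((n : ℝ) + s)) :=
      lintegral_mono_set (sdiff_subset_sdiff_right (ball_subset_ball hT1))
    refine h1.trans ?_
    rw [ENNReal.ofReal_div_of_pos hs0, ENNReal.ofReal_coe_nnreal,
      ENNReal.le_div_iff_mul_le (Or.inl (by simpa using hs0)) (Or.inl ENNReal.ofReal_ne_top),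
      mul_comm]
    exact hsa.le
  have hJ1 : J E₀ ≠ ∞ := ne_top_of_le_ne_top ENNReal.ofReal_ne_top hJle
  have hJ2 : J E₀ᶜ ≠ ∞ := by
    refine ne_top_of_le_ne_top ENNReal.ofReal_ne_top (le_trans ?_ hJsum.le)
    exact le_add_self
  have hker : ∀ y, T ≤ ‖y‖ → _ := fun y hy =>
    rieszKernel_le_and_ge hM ht (le_max_right _ _ : t * M / (t - 1) ≤ T) hs hx hy
  have hmem : ∀ S : Set (EuclideanSpace ℝ (Fin n)),
      ∀ᵐ y ∂volume.restrict (S \ ball 0 T), T ≤ ‖y‖ := by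
    intro S
    have : ∀ᵐ y ∂volume.restrict (S \ ball 0 T),
        y ∈ (ball (0 : EuclideanSpace ℝ (Fin n)) T)ᶜ :=
      ae_mono (Measure.restrict_mono (fun y hy => hy.2) le_rfl)
        (ae_restrict_mem measurableSet_ball.compl)
    filter_upwards [this] with y hy
    simpa using hy
  have hup : ∫⁻ y in E₀ \ ball 0 T, rieszKernel s x y ≤ ENNReal.ofReal L * J E₀ := by
    rw [← lintegral_const_mul _ (by fun_prop)]
    exact lintegral_mono_ae ((hmem E₀).mono fun y hy => (hker y hy).1)
  have hlow : ENNReal.ofReal L⁻¹ * J E₀ᶜ ≤ ∫⁻ y in E₀ᶜ \ ball 0 T, rieszKernel s x y := by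
    rw [← lintegral_const_mul _ (by fun_prop)]
    exact lintegral_mono_ae ((hmem E₀ᶜ).mono fun y hy => (hker y hy).2)
  refine (add_le_add hup le_rfl).trans (le_trans ?_ hlow)
  have hω0 : 0 ≤ ω := ENNReal.toReal_nonneg
  have hJsum' : (J E₀).toReal + (J E₀ᶜ).toReal = ω * T ^ (-s) / s := by
    rw [← ENNReal.toReal_add hJ1 hJ2, hJsum, ENNReal.toReal_ofReal (by positivity)]
  have hJle' : (J E₀).toReal ≤ a / s :=
    ENNReal.toReal_le_of_le_ofReal (by positivity) hJle
  rw [← ENNReal.ofReal_toReal hJ1, ← ENNReal.ofReal_toReal hJ2, ← ENNReal.ofReal_mul hL.le,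
    ← ENNReal.ofReal_mul (inv_pos.2 hL).le,
    ← ENNReal.ofReal_add (by positivity) (by positivity)]
  apply ENNReal.ofReal_le_ofReal
  have e : (J E₀ᶜ).toReal = ω * T ^ (-s) / s - (J E₀).toReal := by linarith
  rw [e]
  have hgt : g t = L⁻¹ * ω - (L + L⁻¹) * a := rfl
  have h1 : (L + L⁻¹) * (J E₀).toReal ≤ (L + L⁻¹) * (a / s) := by gcongr
  have h2 : (L + L⁻¹) * (a / s) + g t / 2 / s ≤ L⁻¹ * (ω * T ^ (-s) / s) := by
    have : ((L + L⁻¹) * a + g t / 2) / s ≤ (L⁻¹ * ω * T ^ (-s)) / s := by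
      gcongr
      linarith
    calc _ = ((L + L⁻¹) * a + g t / 2) / s := by ring
      _ ≤ _ := this
      _ = _ := by ring
  linarith


/-! ### Spreading of empty balls -/

/-- If a minimal set misses a ball, it misses every larger concentric ball in which it has no
exterior data, as soon as `s` is small in terms of the inner radius alone: otherwise removing the
part `A` of the set in the larger ball costs at most `Q |A|` near `A`, by the calibration, and
gains `η |A| / s` at infinity. -/
theorem eventually_volume_inter_ball_eq_zero {Ω E₀ : Set (EuclideanSpace ℝ (Fin n))}
    (hΩ : IsOpen Ω) (hΩb : Bornology.IsBounded Ω) (hE₀ : NullMeasurableSet E₀ volume)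
    (hα : upperAlpha E₀ < sphereArea n / 2) {δ : ℝ} (hδ : 0 < δ) (M : ℝ) :
    ∀ᶠ s in 𝓝[>] (0 : ℝ), ∀ E : Set (EuclideanSpace ℝ (Fin n)), IsSMinimal s Ω E →
      E \ Ω =ᵐ[volume] E₀ → ∀ (c : EuclideanSpace ℝ (Fin n)) (r : ℝ), ‖c‖ + r ≤ M →
      volume (E ∩ ball c δ) = 0 → volume (E ∩ ball c r ∩ Ωᶜ) = 0 →
      volume (E ∩ ball c r) = 0 := by
  obtain ⟨M₁, hM₁, hΩM₁⟩ := hΩb.subset_ball_lt 0 0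
  let N : ℝ := max M M₁
  have hN : 0 < N := lt_max_of_lt_right hM₁
  obtain ⟨T, hNT, η, hη, hfar⟩ := exists_eventually_far_le hE₀ hα hN
  let τ : ℝ := T + N + 1
  obtain ⟨Q, hQ, hcal⟩ := exists_interaction_le_of_subset_ball n hδ
    (show (1 : ℝ) ≤ τ by simp only [τ]; linarith)
  have hsη : (0 : ℝ) < η / (Q.toReal + 1) := by positivity
  filter_upwards [hfar, Ioc_mem_nhdsGT (show (0 : ℝ) < 1 / 2 by norm_num),
    Ioo_mem_nhdsGT hsη] with s hfar hs hs' E hE hEE₀ c r hcr hδ0 hΩ0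
  have hs0 : 0 < s := hs.1
  have hQs : Q < ENNReal.ofReal (η / s) := by
    rw [← ENNReal.ofReal_toReal hQ, ENNReal.ofReal_lt_ofReal_iff (by positivity),
      lt_div_iff₀ hs0]
    have h1 := (lt_div_iff₀ (show (0 : ℝ) < Q.toReal + 1 by positivity)).1 hs'.2
    nlinarith
  rcases le_or_gt r 0 with hr0 | hr0
  · simp [ball_eq_empty.2 hr0]
  have hMN : M ≤ N := le_max_left _ _
  have hcN : ‖c‖ ≤ N := by linarith
  have hΩT : Ω ⊆ ball 0 T := hΩM₁.trans (ball_subset_ball ((le_max_right _ _).trans hNT))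
  have hrN : ball c r ⊆ ball 0 N := ball_subset_ball' (by
    rw [dist_zero_right]; linarith)
  have hrT : ball c r ⊆ ball 0 T := hrN.trans (ball_subset_ball hNT)
  have hTτ : ball 0 T ⊆ ball c τ := ball_subset_ball' (by
    rw [dist_zero_left]; simp only [τ]; linarith)
  let A : Set (EuclideanSpace ℝ (Fin n)) := (E ∩ ball c r ∩ Ω) \ ball c δ
  have hAm : NullMeasurableSet A volume :=
    ((hE.measurable.inter measurableSet_ball.nullMeasurableSet).inter
      hΩ.measurableSet.nullMeasurableSet).diff measurableSet_ball.nullMeasurableSet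
  have hAE : A ⊆ E ∩ Ω := fun x hx => ⟨hx.1.1.1, hx.1.2⟩
  have hAr : A ⊆ ball c r := fun x hx => hx.1.1.2
  have hAball : A ⊆ ball c r \ ball c δ := fun x hx => ⟨hx.1.1.2, hx.2⟩
  -- almost every point of `E` in the larger ball belongs to `A`
  have haeA : ∀ᵐ y, y ∈ E → y ∈ ball c r → y ∈ A := by
    have h1 := measure_eq_zero_iff_ae_notMem.1 hδ0
    have h2 := measure_eq_zero_iff_ae_notMem.1 hΩ0
    filter_upwards [h1, h2] with y h1 h2 hyE hyr
    exact ⟨⟨⟨hyE, hyr⟩, by_contra fun h => h2 ⟨⟨hyE, hyr⟩, h⟩⟩, fun h => h1 ⟨hyE, h⟩⟩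
  have haeE₀ : ∀ᵐ y, y ∈ E \ Ω ↔ y ∈ E₀ := hEE₀.mem_iff
  have hAfin : volume A ≠ ∞ := measure_ne_top_of_subset hAr measure_ball_lt_top.ne
  obtain ⟨hfin, hmin⟩ := hE.interaction_le hΩ.measurableSet hAm hAE
  have hk := measurable_rieszKernel (n := n) s
  have hup : interaction s A (E \ A) ≤
      interaction s A (ball c τ \ ball c r) + interaction s A (E₀ \ ball 0 T) := by
    simp only [interaction_eq_pairIntegral]
    refine (pairIntegral_mono_right ?_).trans (pairIntegral_union_right_le hk _ _ _)
    filter_upwards [haeA, haeE₀] with y h1 h2 hy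
    by_cases hyT : y ∈ ball 0 T
    · exact Or.inl ⟨hTτ hyT, fun h => hy.2 (h1 hy.1 h)⟩
    · exact Or.inr ⟨h2.1 ⟨hy.1, fun h => hyT (hΩT h)⟩, hyT⟩
  have hlow : interaction s A (ball c r \ A) + interaction s A (E₀ᶜ \ ball 0 T) ≤
      interaction s A Eᶜ := by
    simp only [interaction_eq_pairIntegral]
    rw [← pairIntegral_union_right hk _
      (hE₀.compl.diff measurableSet_ball.nullMeasurableSet)]
    · refine pairIntegral_mono_right ?_
      filter_upwards [haeA, haeE₀] with y h1 h2 hy hyE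
      rcases hy with hy | hy
      · exact hy.2 (h1 hyE hy.1)
      · exact hy.1 (h2.1 ⟨hyE, fun h => hy.2 (hΩT h)⟩)
    · exact (disjoint_left.2 fun y hy hy' => hy'.2 (hrT hy.1)).aedisjoint
  have hinf : interaction s A (E₀ \ ball 0 T) + ENNReal.ofReal (η / s) * volume A ≤
      interaction s A (E₀ᶜ \ ball 0 T) := by
    unfold interaction
    rw [← setLIntegral_const, ← lintegral_add_right _ measurable_const]
    refine lintegral_mono_ae ((ae_restrict_mem₀ hAm).mono fun x hx => hfar x ?_)
    exact (mem_ball_zero_iff.1 (hrN (hAr hx))).le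
  have hnear := hcal s hs r (by simp only [τ]; linarith [norm_nonneg c]) c A hAm hAball
  have hkey : interaction s A Eᶜ + ENNReal.ofReal (η / s) * volume A ≤
      interaction s A Eᶜ + Q * volume A := by
    calc interaction s A Eᶜ + ENNReal.ofReal (η / s) * volume A
        ≤ interaction s A (ball c τ \ ball c r) + interaction s A (E₀ \ ball 0 T) +
            ENNReal.ofReal (η / s) * volume A := by gcongr; exact hmin.trans hup
      _ ≤ interaction s A (ball c τ \ ball c r) + interaction s A (E₀ᶜ \ ball 0 T) := by
          rw [add_assoc]; gcongr
      _ ≤ interaction s A (ball c r \ A) + Q * volume A +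
            interaction s A (E₀ᶜ \ ball 0 T) := by gcongr
      _ = interaction s A (ball c r \ A) + interaction s A (E₀ᶜ \ ball 0 T) +
            Q * volume A := by ring
      _ ≤ _ := by gcongr
  have hA0 : volume A = 0 := by
    by_contra hne
    have h1 := (ENNReal.add_le_add_iff_left hfin.ne).1 hkey
    exact absurd ((ENNReal.mul_le_mul_iff_left hne hAfin).1 h1) (not_le.2 hQs)
  refine measure_eq_zero_iff_ae_notMem.2 ?_
  filter_upwards [haeA, measure_eq_zero_iff_ae_notMem.1 hA0] with y h1 h2 hy
  exact h2 (h1 hy.1 hy.2)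


/-! ### Regions that minimal sets miss for small `s` -/

/-- For all sufficiently small `s`, every `s`-minimal set in `Ω` with exterior data `E₀` misses
`U`, up to a null set. The threshold for `s` depends on `U`, but not on the minimal set. -/
def EventuallyNull (Ω E₀ U : Set (EuclideanSpace ℝ (Fin n))) : Prop :=
  ∀ᶠ s in 𝓝[>] (0 : ℝ), ∀ E : Set (EuclideanSpace ℝ (Fin n)), IsSMinimal s Ω E →
    E \ Ω =ᵐ[volume] E₀ → volume (E ∩ U) = 0

section EventuallyNull

variable {Ω E₀ U V : Set (EuclideanSpace ℝ (Fin n))}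

theorem EventuallyNull.mono (h : EventuallyNull Ω E₀ V) (hUV : U ⊆ V) :
    EventuallyNull Ω E₀ U := by
  filter_upwards [h] with s hs E hE hE₀
  exact measure_mono_null (inter_subset_inter_right E hUV) (hs E hE hE₀)

theorem EventuallyNull.union (hU : EventuallyNull Ω E₀ U) (hV : EventuallyNull Ω E₀ V) :
    EventuallyNull Ω E₀ (U ∪ V) := by
  filter_upwards [hU, hV] with s hs hs' E hE hE₀
  rw [inter_union_distrib_left]
  exact measure_union_null (hs E hE hE₀) (hs' E hE hE₀)

theorem volume_inter_inter_compl_eq_zero {E : Set (EuclideanSpace ℝ (Fin n))}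
    (hE : E \ Ω =ᵐ[volume] E₀) (hU : U \ Ω ⊆ E₀ᶜ) : volume (E ∩ U ∩ Ωᶜ) = 0 := by
  rw [measure_eq_zero_iff_ae_notMem]
  filter_upwards [hE.mem_iff] with y hy h
  exact hU ⟨h.1.2, h.2⟩ (hy.1 ⟨h.1.1, h.2⟩)

theorem EventuallyNull.ball_of_ball (hΩ : IsOpen Ω) (hΩb : Bornology.IsBounded Ω)
    (hE₀ : NullMeasurableSet E₀ volume) (hα : upperAlpha E₀ < sphereArea n / 2)
    {c : EuclideanSpace ℝ (Fin n)} {δ r : ℝ} (hδ : 0 < δ)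
    (h : EventuallyNull Ω E₀ (ball c δ)) (hr : ball c r \ Ω ⊆ E₀ᶜ) :
    EventuallyNull Ω E₀ (ball c r) := by
  filter_upwards [h, eventually_volume_inter_ball_eq_zero hΩ hΩb hE₀ hα hδ (‖c‖ + r)] with
    s hs hs' E hE hEE₀
  exact hs' E hE hEE₀ c r le_rfl (hs E hE hEE₀) (volume_inter_inter_compl_eq_zero hEE₀ hr)

/-- Being missed by minimal sets near one point of a connected `Ω` propagates to all its compact
subsets. -/
theorem EventuallyNull.of_isCompact (hΩ : IsOpen Ω) (hΩb : Bornology.IsBounded Ω)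
    (hΩc : IsPreconnected Ω) (hE₀ : NullMeasurableSet E₀ volume)
    (hα : upperAlpha E₀ < sphereArea n / 2)
    (h : ∃ y ∈ Ω, ∃ r > 0, EventuallyNull Ω E₀ (ball y r))
    {K : Set (EuclideanSpace ℝ (Fin n))} (hK : IsCompact K) (hKΩ : K ⊆ Ω) :
    EventuallyNull Ω E₀ K := by
  let G : Set (EuclideanSpace ℝ (Fin n)) := {y | ∃ r > 0, EventuallyNull Ω E₀ (ball y r)}
  have hsub : ∀ {x y : EuclideanSpace ℝ (Fin n)} {r : ℝ}, EventuallyNull Ω E₀ (ball y r) →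
      dist x y < r → x ∈ G := fun {x y r} hr hxy =>
    ⟨r - dist x y, sub_pos.2 hxy, hr.mono (ball_subset_ball' (by linarith))⟩
  have hGo : IsOpen G := by
    rw [Metric.isOpen_iff]
    rintro y ⟨r, hr, hy⟩
    exact ⟨r, hr, fun x hx => hsub hy hx⟩
  have hG : Ω ⊆ G := by
    refine hΩc.subset_of_closure_inter_subset hGo ?_ ?_
    · obtain ⟨y, hy, r, hr, hyr⟩ := h
      exact ⟨y, hy, r, hr, hyr⟩
    · rintro x ⟨hx, hxΩ⟩
      obtain ⟨ε, hε, hεΩ⟩ := Metric.isOpen_iff.1 hΩ x hxΩ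
      obtain ⟨y, ⟨r, hr, hyr⟩, hxy⟩ := Metric.mem_closure_iff.1 hx (ε / 2) (by positivity)
      have hball : ball y (ε / 2) ⊆ Ω := (ball_subset_ball' (by
        rw [dist_comm]; linarith)).trans hεΩ
      refine hsub (EventuallyNull.ball_of_ball hΩ hΩb hE₀ hα hr hyr (r := ε / 2) ?_) hxy
      rw [sdiff_eq_empty.2 hball]
      exact empty_subset _
  refine hK.induction_on (p := fun S => EventuallyNull Ω E₀ S) ?_ (fun S S' hSS' h => h.mono hSS')
    (fun S S' hS hS' => hS.union hS') fun x hx => ?_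
  · exact Eventually.of_forall fun s E _ _ => by simp
  · obtain ⟨r, hr, hxr⟩ := hG (hKΩ hx)
    exact ⟨ball x r, mem_nhdsWithin_of_mem_nhds (ball_mem_nhds x hr), hxr⟩

end EventuallyNull

/-! ### Exterior and interior balls of domains with `C²` boundary -/

theorem HasC2Boundary.exists_ball_subset_compl {Ω : Set (EuclideanSpace ℝ (Fin n))}
    (hC2 : HasC2Boundary Ω) (hΩ : IsOpen Ω) {x₀ : EuclideanSpace ℝ (Fin n)}
    (hx₀ : x₀ ∈ frontier Ω) {ε : ℝ} (hε : 0 < ε) :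
    ∃ z ∈ ball x₀ ε, ∃ δ > 0, ball z δ ⊆ ball x₀ ε \ Ω := by
  obtain ⟨r, hr, φ, hφ, hdφ, hφΩ⟩ := hC2 x₀ hx₀
  have hx₀Ω : x₀ ∉ Ω := by
    rw [hΩ.frontier_eq] at hx₀; exact hx₀.2
  have hφ0 : 0 ≤ φ x₀ := by
    by_contra! h
    have : x₀ ∈ Ω ∩ ball x₀ r := by rw [hφΩ]; exact ⟨h, mem_ball_self hr⟩
    exact hx₀Ω this.1
  -- `φ` has no local maximum at `x₀`, as its differential does not vanish there
  obtain ⟨z, hz1, hz2⟩ : ∃ z ∈ ball x₀ (min ε r), 0 < φ z := by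
    by_contra! h
    refine hdφ x₀ (mem_ball_self hr) (IsLocalMax.fderiv_eq_zero ?_)
    filter_upwards [ball_mem_nhds x₀ (lt_min hε hr)] with z hz
    exact (h z hz).trans hφ0
  have hzr : z ∈ ball x₀ r := ball_subset_ball (min_le_right _ _) hz1
  have hzε : z ∈ ball x₀ ε := ball_subset_ball (min_le_left _ _) hz1
  have hpos : ∀ᶠ w in 𝓝 z, 0 < φ w :=
    (hφ.continuousOn.continuousAt (isOpen_ball.mem_nhds hzr)).eventually (lt_mem_nhds hz2)
  obtain ⟨δ, hδ, hδs⟩ := Metric.eventually_nhds_iff_ball.1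
    (hpos.and ((isOpen_ball.eventually_mem hzr).and (isOpen_ball.eventually_mem hzε)))
  refine ⟨z, hzε, δ, hδ, fun w hw => ⟨(hδs w hw).2.2, fun hwΩ => ?_⟩⟩
  have : w ∈ {y | φ y < 0} ∩ ball x₀ r := by rw [← hφΩ]; exact ⟨hwΩ, (hδs w hw).2.1⟩
  exact absurd (hδs w hw).1 (not_lt.2 (le_of_lt this.1))

/-- Near a boundary point, the ball of radius `ρ` that is internally tangent at `x` to the level set
of `φ` through `x` lies in `{φ ≤ φ x}`, by the second order Taylor bound. -/
theorem HasC2Boundary.exists_interior_closedBall_near {Ω : Set (EuclideanSpace ℝ (Fin n))}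
    (hC2 : HasC2Boundary Ω) {p : EuclideanSpace ℝ (Fin n)} (hp : p ∈ frontier Ω) :
    ∃ ε > 0, ∃ ρ₀ > 0, ∀ ρ ∈ Ioc 0 ρ₀, ∀ x ∈ Ω ∩ ball p ε,
      ∃ c, closedBall c ρ ⊆ Ω ∧ x ∈ closedBall c ρ := by
  obtain ⟨r, hr, φ, hφ, hdφ, hφΩ⟩ := hC2 p hp
  have hφp : ContDiffAt ℝ 2 φ p := hφ.contDiffAt (ball_mem_nhds p hr)
  have hfd : ContDiffAt ℝ 1 (fderiv ℝ φ) p := hφp.fderiv_right (by norm_num)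
  obtain ⟨K, t, ht, hK⟩ := hfd.exists_lipschitzOnWith
  let m : ℝ := ‖fderiv ℝ φ p‖ / 2
  have hnp : 0 < ‖fderiv ℝ φ p‖ := norm_pos_iff.2 (hdφ p (mem_ball_self hr))
  have hm : 0 < m := by positivity
  have hlarge : ∀ᶠ y in 𝓝 p, m < ‖fderiv ℝ φ y‖ :=
    hfd.continuousAt.norm.eventually (lt_mem_nhds (by simp only [m]; linarith))
  obtain ⟨ε, hε, hεs⟩ := Metric.eventually_nhds_iff_ball.1
    (hlarge.and ((isOpen_ball.eventually_mem (mem_ball_self hr)).and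
      (eventually_mem_set.2 ht)))
  have hdiff : ∀ y ∈ ball p ε, DifferentiableAt ℝ φ y := fun y hy =>
    (hφ.contDiffAt (isOpen_ball.mem_nhds (hεs y hy).2.1)).differentiableAt (by norm_num)
  refine ⟨ε / 2, by positivity, min (ε / 8) (m / (2 * (K + 1))), by positivity,
    fun ρ hρ x hx => ?_⟩
  have hρ0 : 0 < ρ := hρ.1
  have hρε : ρ ≤ ε / 8 := hρ.2.trans (min_le_left _ _)
  have hρK : ρ * (2 * (K + 1)) ≤ m :=
    (le_div_iff₀ (by positivity)).1 (hρ.2.trans (min_le_right _ _))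
  have hxε : x ∈ ball p ε := ball_subset_ball (by linarith) hx.2
  have hφx : φ x < 0 := by
    have : x ∈ {y | φ y < 0} ∩ ball p r := by rw [← hφΩ]; exact ⟨hx.1, (hεs x hxε).2.1⟩
    exact this.1
  let g : EuclideanSpace ℝ (Fin n) := (InnerProductSpace.toDual ℝ _).symm (fderiv ℝ φ x)
  have hg : ∀ v, fderiv ℝ φ x v = inner ℝ g v := fun v =>
    (InnerProductSpace.toDual_symm_apply).symm
  have hgm : m < ‖g‖ := by
    simp only [g, LinearIsometryEquiv.norm_map]
    exact (hεs x hxε).1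
  have hg0 : 0 < ‖g‖ := hm.trans hgm
  let c : EuclideanSpace ℝ (Fin n) := x - (ρ / ‖g‖) • g
  have hnorm : ‖(ρ / ‖g‖) • g‖ = ρ := by
    rw [norm_smul, Real.norm_of_nonneg (by positivity)]; field_simp
  have hxc : x ∈ closedBall c ρ := by
    rw [mem_closedBall_iff_norm, sub_sub_cancel, hnorm]
  refine ⟨c, fun z hz => ?_, hxc⟩
  have hzε : z ∈ ball p ε := by
    have h1 := dist_triangle z c x
    have h2 := dist_triangle z x p
    have h3 : dist z c ≤ ρ := hz
    have h4 : dist x c ≤ ρ := hxc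
    rw [dist_comm x c] at h4
    have h5 : dist x p < ε / 2 := hx.2
    rw [mem_ball]
    linarith
  have hinner : inner ℝ g (z - x) ≤ -(‖g‖ * ‖z - x‖ ^ 2 / (2 * ρ)) := by
    have h1 : ‖(z - x) + (ρ / ‖g‖) • g‖ ^ 2 ≤ ρ ^ 2 := by
      have : (z - x) + (ρ / ‖g‖) • g = z - c := by simp only [c]; abel
      rw [this]
      have := mem_closedBall_iff_norm.1 hz
      gcongr
    rw [norm_add_sq_real, hnorm, real_inner_smul_right, real_inner_comm] at h1
    have h2 : 2 * (ρ / ‖g‖ * inner ℝ g (z - x)) ≤ -‖z - x‖ ^ 2 := by linarith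
    have h3 : inner ℝ g (z - x) = 2 * (ρ / ‖g‖ * inner ℝ g (z - x)) * (‖g‖ / (2 * ρ)) := by
      field_simp
    rw [h3]
    calc _ ≤ -‖z - x‖ ^ 2 * (‖g‖ / (2 * ρ)) := by gcongr
      _ = _ := by ring
  have htaylor : ‖φ z - φ x - fderiv ℝ φ x (z - x)‖ ≤ (K * ‖z - x‖) * ‖z - x‖ := by
    have hseg : segment ℝ x z ⊆ ball p ε := (convex_ball p ε).segment_subset hxε hzε
    refine (convex_segment x z).norm_image_sub_le_of_norm_hasFDerivWithin_le'
      (f' := fderiv ℝ φ) (fun w hw => (hdiff w (hseg hw)).hasFDerivAt.hasFDerivWithinAt)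
      (fun w hw => ?_) (left_mem_segment ℝ x z) (right_mem_segment ℝ x z)
    refine (hK.norm_sub_le (hεs w (hseg hw)).2.2 (hεs x hxε).2.2).trans ?_
    gcongr
    exact norm_sub_le_of_mem_segment hw
  have hφz : φ z < 0 := by
    rw [hg, Real.norm_eq_abs, abs_le] at htaylor
    have h1 : K * ‖z - x‖ * ‖z - x‖ ≤ ‖g‖ * ‖z - x‖ ^ 2 / (2 * ρ) := by
      rw [le_div_iff₀ (by positivity)]
      have : K * (2 * ρ) ≤ ‖g‖ := by nlinarith
      calc K * ‖z - x‖ * ‖z - x‖ * (2 * ρ) = K * (2 * ρ) * ‖z - x‖ ^ 2 := by ring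
        _ ≤ _ := by gcongr
    linarith [htaylor.2]
  have : z ∈ Ω ∩ ball p r := by rw [hφΩ]; exact ⟨hφz, (hεs z hzε).2.1⟩
  exact this.1

/-- A bounded open set with `C²` boundary is a union of closed balls of one and the same radius. -/
theorem HasC2Boundary.exists_interior_closedBall {Ω : Set (EuclideanSpace ℝ (Fin n))}
    (hC2 : HasC2Boundary Ω) (hΩ : IsOpen Ω) (hΩb : Bornology.IsBounded Ω) :
    ∃ ρ > 0, ∀ x ∈ Ω, ∃ c, closedBall c ρ ⊆ Ω ∧ x ∈ closedBall c ρ := by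
  have hcomp : IsCompact (closure Ω) := hΩb.isCompact_closure
  suffices h : ∃ ρ₀ > 0, ∀ ρ ∈ Ioc 0 ρ₀, ∀ x ∈ Ω ∩ closure Ω,
      ∃ c, closedBall c ρ ⊆ Ω ∧ x ∈ closedBall c ρ by
    obtain ⟨ρ₀, hρ₀, h⟩ := h
    exact ⟨ρ₀, hρ₀, fun x hx => h ρ₀ ⟨hρ₀, le_rfl⟩ x ⟨hx, subset_closure hx⟩⟩
  refine hcomp.induction_on (p := fun S => ∃ ρ₀ > 0, ∀ ρ ∈ Ioc 0 ρ₀, ∀ x ∈ Ω ∩ S,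
      ∃ c, closedBall c ρ ⊆ Ω ∧ x ∈ closedBall c ρ) ?_ ?_ ?_ ?_
  · exact ⟨1, one_pos, fun ρ _ x hx => absurd hx.2 (notMem_empty x)⟩
  · rintro S S' hSS' ⟨ρ₀, hρ₀, h⟩
    exact ⟨ρ₀, hρ₀, fun ρ hρ x hx => h ρ hρ x ⟨hx.1, hSS' hx.2⟩⟩
  · rintro S S' ⟨ρ₀, hρ₀, h⟩ ⟨ρ₁, hρ₁, h'⟩
    refine ⟨min ρ₀ ρ₁, lt_min hρ₀ hρ₁, fun ρ hρ x hx => ?_⟩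
    rcases hx.2 with hxS | hxS
    · exact h ρ ⟨hρ.1, hρ.2.trans (min_le_left _ _)⟩ x ⟨hx.1, hxS⟩
    · exact h' ρ ⟨hρ.1, hρ.2.trans (min_le_right _ _)⟩ x ⟨hx.1, hxS⟩
  · intro x hx
    by_cases hxΩ : x ∈ Ω
    · obtain ⟨ε, hε, hεΩ⟩ := Metric.isOpen_iff.1 hΩ x hxΩ
      refine ⟨ball x (ε / 2), mem_nhdsWithin_of_mem_nhds (ball_mem_nhds x (by positivity)),
        ε / 4, by positivity, fun ρ hρ y hy => ⟨y, fun z hz => hεΩ ?_, ?_⟩⟩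
      · have h1 : dist z y ≤ ρ := hz
        have h2 : dist y x < ε / 2 := hy.2
        have h3 := dist_triangle z y x
        have h4 := hρ.2
        rw [mem_ball]; linarith
      · exact mem_closedBall_self hρ.1.le
    · obtain ⟨ε, hε, ρ₀, hρ₀, h⟩ := hC2.exists_interior_closedBall_near
        (show x ∈ frontier Ω by rw [hΩ.frontier_eq]; exact ⟨hx, hxΩ⟩)
      exact ⟨ball x ε, mem_nhdsWithin_of_mem_nhds (ball_mem_nhds x hε), ρ₀, hρ₀, h⟩

/-! ### Minimal sets are empty for small `s` -/

theorem eventually_inter_eq_empty {Ω E₀ : Set (EuclideanSpace ℝ (Fin n))}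
    (hΩ : IsOpen Ω) (hΩb : Bornology.IsBounded Ω) (hΩc : IsPreconnected Ω)
    (hC2 : HasC2Boundary Ω) (hE₀ : NullMeasurableSet E₀ volume)
    (hα : upperAlpha E₀ < sphereArea n / 2) {R : ℝ} (hR : 0 < R)
    {x₀ : EuclideanSpace ℝ (Fin n)} (hx₀ : x₀ ∈ frontier Ω) (hempty : ball x₀ R \ Ω ⊆ E₀ᶜ) :
    ∀ᶠ s in 𝓝[>] (0 : ℝ), ∀ E : Set (EuclideanSpace ℝ (Fin n)), IsNormalized E →
      IsSMinimal s Ω E → E \ Ω =ᵐ[volume] E₀ → E ∩ Ω = ∅ := by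
  -- an empty ball outside `Ω` near `x₀` spreads into `Ω`
  have hstart : ∃ y ∈ Ω, ∃ r > 0, EventuallyNull Ω E₀ (ball y r) := by
    obtain ⟨z, hz, δ, hδ, hzδ⟩ :=
      hC2.exists_ball_subset_compl hΩ hx₀ (show 0 < R / 2 by positivity)
    have hzδ0 : EventuallyNull Ω E₀ (ball z δ) := by
      refine Eventually.of_forall fun s E _ hEE₀ => ?_
      have h := volume_inter_inter_compl_eq_zero (U := ball z δ) hEE₀ fun y hy =>
        hempty ⟨ball_subset_ball (by linarith) (hzδ hy.1).1, hy.2⟩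
      refine measure_mono_null (fun y hy => ?_) h
      exact ⟨hy, (hzδ hy.2).2⟩
    have hzR : EventuallyNull Ω E₀ (ball z (R / 2)) := by
      refine EventuallyNull.ball_of_ball hΩ hΩb hE₀ hα hδ hzδ0 fun y hy => hempty ⟨?_, hy.2⟩
      refine ball_subset_ball' ?_ hy.1
      have : dist z x₀ < R / 2 := hz
      linarith
    obtain ⟨y, hy, hyΩ⟩ := mem_closure_iff.1 (frontier_subset_closure hx₀) (ball z (R / 2))
      isOpen_ball (mem_ball_comm.1 hz)
    exact ⟨y, hyΩ, R / 2 - dist y z, sub_pos.2 hy, hzR.mono (ball_subset_ball' (by linarith))⟩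
  obtain ⟨ρ, hρ, hint⟩ := hC2.exists_interior_closedBall hΩ hΩb
  -- the compact set of all points at distance at least `ρ / 2` from the complement
  have hK : EventuallyNull Ω E₀ (thickening (ρ / 2) Ωᶜ)ᶜ := by
    have hKΩ : (thickening (ρ / 2) Ωᶜ)ᶜ ⊆ Ω :=
      compl_subset_comm.1 (self_subset_thickening (by positivity) _)
    exact EventuallyNull.of_isCompact hΩ hΩb hΩc hE₀ hα hstart
      (isCompact_of_isClosed_isBounded isOpen_thickening.isClosed_compl (hΩb.subset hKΩ)) hKΩ
  obtain ⟨M, hM⟩ := hΩb.subset_ball 0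
  filter_upwards [hK, eventually_volume_inter_ball_eq_zero hΩ hΩb hE₀ hα
    (show 0 < ρ / 2 by positivity) (M + (ρ + 1))] with s hsK hs E hnorm hE hEE₀
  refine eq_empty_iff_forall_notMem.2 fun x hx => ?_
  obtain ⟨c, hc, hxc⟩ := hint x hx.2
  -- `x` may lie on the boundary sphere of the interior ball, which is therefore enlarged
  obtain ⟨ε, hε, hεΩ⟩ := (isCompact_closedBall c ρ).exists_thickening_subset_open hΩ hc
  let r : ℝ := ρ + min ε 1
  have hrpos : 0 < min ε 1 := lt_min hε one_pos
  have hrΩ : ball c r ⊆ Ω := by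
    refine subset_trans (fun y hy => ?_) hεΩ
    rw [thickening_closedBall hε hρ.le]
    exact ball_subset_ball (by simp only [r]; linarith [min_le_left ε 1]) hy
  have hcM : ‖c‖ < M := mem_ball_zero_iff.1 (hM (hc (mem_closedBall_self hρ.le)))
  have hinner : volume (E ∩ ball c (ρ / 2)) = 0 := by
    refine measure_mono_null (inter_subset_inter_right E ?_) (hsK E hE hEE₀)
    intro y hy hy'
    obtain ⟨w, hw, hyw⟩ := mem_thickening_iff.1 hy'
    refine hw (hc ?_)
    have h1 := dist_triangle w y c
    have h2 : dist y c < ρ / 2 := hy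
    rw [dist_comm w y] at h1
    rw [mem_closedBall]; linarith
  have hball : volume (E ∩ ball c r) = 0 := by
    refine hs E hE hEE₀ c r ?_ hinner ?_
    · simp only [r]; linarith [min_le_right ε 1]
    · exact volume_inter_inter_compl_eq_zero hEE₀ fun y hy => absurd (hrΩ hy.1) hy.2
  have hxr : dist x c < r := lt_of_le_of_lt hxc (by simp only [r]; linarith)
  refine hnorm.exterior_subset ⟨r - dist x c, sub_pos.2 hxr, ?_⟩ hx.1
  exact measure_mono_null (inter_subset_inter_right E (ball_subset_ball' (by linarith))) hball

end NonlocalMinimal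

theorem theorem1p5 (n : ℕ) (Ω E₀ : Set (EuclideanSpace ℝ (Fin n)))
    (hΩ_open : IsOpen Ω) (hΩ_bdd : Bornology.IsBounded Ω) (hΩ_conn : IsConnected Ω)
    (hΩ_C2 : NonlocalMinimal.HasC2Boundary Ω)
    (hE₀_meas : NullMeasurableSet E₀ volume) (hE₀ : E₀ ⊆ Ωᶜ)
    (hα : NonlocalMinimal.upperAlpha E₀ < NonlocalMinimal.sphereArea n / 2)
    (hempty : ∃ R : ℝ, 0 < R ∧ ∃ x₀ ∈ frontier Ω, ball x₀ R \ Ω ⊆ E₀ᶜ)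
    (s₁ : ℝ) (hs₁ : s₁ ∈ Ioo (0 : ℝ) 1) :
    ∃ s₃ ∈ Ioc (0 : ℝ) s₁, ∀ s ∈ Ioo (0 : ℝ) s₃, ∀ E : Set (EuclideanSpace ℝ (Fin n)),
      NonlocalMinimal.IsNormalized E → NonlocalMinimal.IsSMinimal s Ω E →
      E \ Ω =ᵐ[volume] E₀ → E ∩ Ω = ∅ := by
  obtain ⟨R, hR, x₀, hx₀, hRE₀⟩ := hempty
  have h := NonlocalMinimal.eventually_inter_eq_empty hΩ_open hΩ_bdd hΩ_conn.isPreconnected hΩ_C2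
    hE₀_meas hα hR hx₀ hRE₀
  obtain ⟨s₃, hs₃, h⟩ := (mem_nhdsGT_iff_exists_Ioo_subset' hs₁.1).1 h
  exact ⟨min s₃ s₁, ⟨lt_min hs₃ hs₁.1, min_le_right _ _⟩,
    fun s hs => h ⟨hs.1, hs.2.trans_le (min_le_left _ _)⟩⟩
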